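/- Let $T,\sigma,\theta,S_0>0$ and $\eta,\zeta\in\mathbb{R}$, and put $\Delta t:=T/N$. Let $(a_N)$, $(b_N)$, $(q_N)$ be real sequences with $q_N>0$ and, as $N\to\infty$, $$a_N=1-\sigma\sqrt{\theta\Delta t}+\zeta\frac{\sigma^2}{2}\theta\Delta t+o(N^{-1}),\qquad b_N=1+\sigma\sqrt{\frac{\Delta t}{\theta}}+\zeta\frac{\sigma^2}{2\theta}\Delta t+o(N^{-1}),$$ $$q_N=1+\eta(\Delta t)^{3/2}+o(N^{-3/2}).$$ For each $N\ge 1$ let $(X_k)_{k\ge1}$ be, under a probability measure $\mathbb{P}_{\theta,q_N}$, a sequence of independent Bernoulli random variables with $$\mathbb{P}_{\theta,q_N}(X_k=0)=\frac{1}{1+\theta q_N^{k-1}},\qquad \mathbb{P}_{\theta,q_N}(X_k=1)=\frac{\theta q_N^{k-1}}{1+\theta q_N^{k-1}},\qquad k\ge1,$$ let $Z_k:=X_1+\cdots+X_k$ with $Z_0:=0$, and let $S_{k,N}:=S_0\,b_N^{Z_k}a_N^{k-Z_k}$ for $k=0,1,\ldots,N$ (positive for all large $N$, almost surely). Let $(B_t)_{t\in[0,T]}$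 be a standard Brownian motion. Then the finite-dimensional distributions of $\left(\log S_{\lfloor Nt/T\rfloor,N}\right)_{t\in[0,T]}$ under $\mathbb{P}_{\theta,q_N}$ converge as $N\to\infty$ to those of $$\left(\log S_0+\frac{\sigma\eta\sqrt{\theta}}{2(1+\theta)}t^2-(1-\zeta)\frac{\sigma^2}{2}t+\sigma B_t\right)_{t\in[0,T]},$$ that is, for all $p\ge1$ and $t_1,\ldots,t_p\in[0,T]$, the random vector $\left(\log S_{\lfloor Nt_i/T\rfloor,N}\right)_{1\le i\le p}$ converges in distribution to the vector of the values of the limit process at $t_1,\ldots,t_p$. -/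

import Mathlib

open MeasureTheory ProbabilityTheory Filter Topology Asymptotics
open scoped NNReal ENNReal

namespace QBinomial

/-- Under `P`, the variables `X 1, X 2, …` are independent Bernoulli variables with
`P (X k = 0) = 1 / (1 + θ q ^ (k - 1))` and `P (X k = 1) = θ q ^ (k - 1) / (1 + θ q ^ (k - 1))`.
The index `0` is not used. -/
structure IsBernoulliSeq {Ω : Type*} [MeasurableSpace Ω] (θ q : ℝ) (X : ℕ → Ω → ℕ)
    (P : Measure Ω) : Prop where
  aemeasurable : ∀ k, 1 ≤ k → AEMeasurable (X k) P
  indep : iIndepFun (fun k : ℕ => X (k + 1)) P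
  prob_zero : ∀ k, 1 ≤ k → P {ω | X k ω = 0} = ENNReal.ofReal (1 / (1 + θ * q ^ (k - 1)))
  prob_one : ∀ k, 1 ≤ k →
    P {ω | X k ω = 1} = ENNReal.ofReal (θ * q ^ (k - 1) / (1 + θ * q ^ (k - 1)))

/-- The random walk `Z_n = X_1 + ⋯ + X_n`. -/
def walk {Ω : Type*} (X : ℕ → Ω → ℕ) (n : ℕ) (ω : Ω) : ℕ :=
  ∑ k ∈ Finset.Icc 1 n, X k ω

/-- The risky asset price `S_n = S₀ b ^ Z_n a ^ (n - Z_n)`; note that `Z_n ≤ n` when the `X_k` take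
their values in `{0, 1}`. -/
noncomputable def price {Ω : Type*} (S₀ a b : ℝ) (X : ℕ → Ω → ℕ) (n : ℕ) (ω : Ω) : ℝ :=
  S₀ * b ^ walk X n ω * a ^ (n - walk X n ω)

/-- Convergence of the finite-dimensional distributions of the processes `(Y N t)_{t ∈ τ}`, where
`Y N` lives on the probability space `(Ω N, P N)`, to those of `(L t)_{t ∈ τ}`, as `N → ∞`. -/
def TendstoFdd {τ : Type*} {Ω : ℕ → Type*} [∀ N, MeasurableSpace (Ω N)]
    {Ω' : Type*} [MeasurableSpace Ω']
    (Y : (N : ℕ) → τ → Ω N → ℝ) (L : τ → Ω' → ℝ)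
    (P : (N : ℕ) → Measure (Ω N)) [∀ N, IsProbabilityMeasure (P N)]
    (P' : Measure Ω') [IsProbabilityMeasure P'] : Prop :=
  ∀ (p : ℕ) (t : Fin p → τ),
    TendstoInDistribution (fun (N : ℕ) (ω : Ω N) (i : Fin p) => Y N (t i) ω) atTop
      (fun (ω : Ω') (i : Fin p) => L (t i) ω) P P'

end QBinomial

/-! By Lévy's continuity theorem it suffices to prove convergence of the characteristic functions of
the vectors of log-prices. A combination `∑ i, c i * log S_{n i}` is a constant plus a sum over
single steps of independent two-valued variables, step `k` being weighted by the sum of the `c i`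
whose time lies beyond `k`. Its characteristic function is therefore a product of `N` explicit
factors `1 + z`, with `z` of order `1/N` uniformly in `k`, and the product tends to `exp` of the
limit of `∑ z` (`tendsto_prod_one_add`).

To order `1/N`, `z` sees only the first two moments of a step (`stepChar_expansion`). At `q = 1` the
mean has no `N ^ (-1/2)` term, because the success probability `θ / (1 + θ)` balances the two
leading jumps; the `1/N` term gives the linear drift. Since `q ^ k` is `1 + η T ^ (3/2) (k/N) N ^
(-1/2)` to leading order (`bernoulliProb_expansion`), the success probability moves by order `N ^
(-1/2)`; times the jump gap, also of order `N ^ (-1/2)`, this adds a mean of order `(k/N)/N`, which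
sums to the `t ^ 2` drift. The variance is unaffected at this order, and squaring the weights
produces the Brownian covariance `min`. -/

namespace QBinomial

/-! ### Characteristic functions: convergence criterion and Brownian side -/

/-- Convergence in distribution in `ι → ℝ` follows from the pointwise convergence of the
characteristic functions. -/
lemma tendstoInDistribution_of_tendsto_integral_exp {ι : Type*} [Fintype ι]
    {Ω : ℕ → Type*} [∀ N, MeasurableSpace (Ω N)]
    {P : (N : ℕ) → Measure (Ω N)} [∀ N, IsProbabilityMeasure (P N)]
    {Ω' : Type*} [MeasurableSpace Ω'] {P' : Measure Ω'} [IsProbabilityMeasure P']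
    {Y : (N : ℕ) → Ω N → ι → ℝ} {Z : Ω' → ι → ℝ}
    (hY : ∀ N, AEMeasurable (Y N) (P N)) (hZ : AEMeasurable Z P')
    (h : ∀ c : ι → ℝ, Tendsto
      (fun N => ∫ ω, Complex.exp (((∑ i, c i * Y N ω i : ℝ) : ℂ) * Complex.I) ∂P N) atTop
      (𝓝 (∫ ω, Complex.exp (((∑ i, c i * Z ω i : ℝ) : ℂ) * Complex.I) ∂P'))) :
    TendstoInDistribution Y atTop Z P P' := by
  -- Lévy's theorem needs an inner product, so it is applied in `EuclideanSpace`; the continuous map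
  -- back to `ι → ℝ` preserves convergence in distribution.
  have key : TendstoInDistribution (fun N ω => WithLp.toLp 2 (Y N ω) : ∀ N, Ω N → EuclideanSpace ℝ ι)
      atTop (fun ω => WithLp.toLp 2 (Z ω)) P P' := by
    have hm : Measurable (WithLp.toLp 2 : (ι → ℝ) → EuclideanSpace ℝ ι) := by fun_prop
    have hY' : ∀ N, AEMeasurable (fun ω => (WithLp.toLp 2 (Y N ω) : EuclideanSpace ℝ ι)) (P N) :=
      fun N => hm.comp_aemeasurable (hY N)
    have hZ' : AEMeasurable (fun ω => (WithLp.toLp 2 (Z ω) : EuclideanSpace ℝ ι)) P' :=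
      hm.comp_aemeasurable hZ
    refine ⟨hY', hZ', ?_⟩
    refine ProbabilityMeasure.tendsto_iff_tendsto_charFun.2 fun c => ?_
    simp only [ProbabilityMeasure.coe_mk, charFun_apply]
    rw [integral_map hZ' (by fun_prop)]
    simp_rw [fun N => integral_map (hY' N)
      (f := fun x : EuclideanSpace ℝ ι => Complex.exp ((inner ℝ x c : ℝ) * Complex.I)) (by fun_prop)]
    simpa [PiLp.inner_apply] using h c.ofLp
  exact key.continuous_comp (g := fun x : EuclideanSpace ℝ ι => x.ofLp) (by fun_prop)

/-- The characteristic function of the finite-dimensional distributions of a Brownian motion. -/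
lemma integral_exp_brownian {ι : Type*} [Fintype ι]
    {Ω' : Type*} [MeasurableSpace Ω'] {P' : Measure Ω'} [IsProbabilityMeasure P']
    {B : ℝ≥0 → Ω' → ℝ} (hB : IsPreBrownianReal B P') (t : ι → ℝ≥0) (c : ι → ℝ) :
    ∫ ω, Complex.exp (((∑ i, c i * B (t i) ω : ℝ) : ℂ) * Complex.I) ∂P'
      = Complex.exp (-((∑ i, ∑ j, c i * c j * min (t i : ℝ) (t j) : ℝ) : ℂ) / 2) := by
  have hG : IsGaussianProcess (fun (i : ι) ω => c i • B (t i) ω) P' :=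
    (hB.isGaussianProcess.comp_right t).smul c
  have hS := hG.hasGaussianLaw_fun_sum (I := Finset.univ)
  -- The coefficients are already inside the sum, so the frequency `1` is enough.
  have h1 := hS.charFun_map_eq (1 : ℝ)
  rw [charFun_apply_real, integral_map hS.aemeasurable (by fun_prop)] at h1
  simp only [smul_eq_mul, Complex.ofReal_one, one_mul] at h1
  rw [h1]
  have hL : ∀ i, MemLp (fun ω => c i * B (t i) ω) 2 P' := fun i =>
    (hG.hasGaussianLaw_eval i).memLp_two
  have hE : ∫ ω, inner ℝ (1 : ℝ) (∑ i, c i * B (t i) ω) ∂P' = 0 := by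
    simp only [RCLike.inner_apply, map_one, mul_one]
    rw [integral_finsetSum _ fun i _ => (hL i).integrable (by norm_num)]
    simp [integral_const_mul, hB.integral_eval]
  have hV : Var[fun ω => inner ℝ (1 : ℝ) (∑ i, c i * B (t i) ω); P']
      = ∑ i, ∑ j, c i * c j * min (t i : ℝ) (t j) := by
    simp only [RCLike.inner_apply, map_one, mul_one]
    rw [variance_fun_sum hL]
    refine Finset.sum_congr rfl fun i _ => Finset.sum_congr rfl fun j _ => ?_
    rw [covariance_const_mul_left, covariance_const_mul_right, hB.covariance_fun_eval]
    push_cast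
    ring
  rw [hE, hV]
  congr 1
  push_cast
  ring

/-! ### The log-price as a sum of independent steps -/

/-- The success probability `θ x / (1 + θ x)`; the variable `X (k + 1)` has it with `x = q ^ k`. -/
noncomputable def bernoulliProb (θ x : ℝ) : ℝ := θ * x / (1 + θ * x)

/-- The sum of the weights `c i` of the times `n i` that lie beyond the step `k`. -/
def activeWeight {ι : Type*} [Fintype ι] (c : ι → ℝ) (n : ι → ℕ) (k : ℕ) : ℝ :=
  ∑ i, if k < n i then c i else 0

lemma sum_ite_lt_mul (c : ℝ) {n N : ℕ} (h : n ≤ N) (x : ℕ → ℝ) :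
    ∑ k ∈ Finset.range N, (if k < n then c else 0) * x k = c * ∑ k ∈ Finset.range n, x k := by
  rw [Finset.mul_sum, ← Finset.sum_subset (Finset.range_mono h)]
  · exact Finset.sum_congr rfl fun k hk => by rw [if_pos (Finset.mem_range.1 hk)]
  · intro k _ hk
    rw [if_neg (by simpa using hk), zero_mul]

/-- Exchanging the sums turns a combination of overlapping partial sums into one sum over steps, so
that independence can be used. -/
lemma sum_activeWeight_mul {ι : Type*} [Fintype ι] (c : ι → ℝ) (n : ι → ℕ) {N : ℕ}
    (h : ∀ i, n i ≤ N) (x : ℕ → ℝ) :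
    ∑ k ∈ Finset.range N, activeWeight c n k * x k
      = ∑ i, c i * ∑ k ∈ Finset.range (n i), x k := by
  simp_rw [activeWeight, Finset.sum_mul]
  rw [Finset.sum_comm]
  exact Finset.sum_congr rfl fun i _ => sum_ite_lt_mul (c i) (h i) x

/-- A product of the indicators of `k < n i` and `k < n j` is that of `k < min (n i) (n j)`; this is
the origin of the covariance `min`. -/
lemma sum_activeWeight_sq_mul {ι : Type*} [Fintype ι] (c : ι → ℝ) (n : ι → ℕ) {N : ℕ}
    (h : ∀ i, n i ≤ N) (x : ℕ → ℝ) :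
    ∑ k ∈ Finset.range N, activeWeight c n k ^ 2 * x k
      = ∑ i, ∑ j, c i * c j * ∑ k ∈ Finset.range (min (n i) (n j)), x k := by
  have hsq : ∀ k, activeWeight c n k ^ 2 * x k
      = ∑ i, ∑ j, (if k < min (n i) (n j) then c i * c j else 0) * x k := fun k => by
    rw [activeWeight, sq, Finset.sum_mul_sum, Finset.sum_mul]
    refine Finset.sum_congr rfl fun i _ => ?_
    rw [Finset.sum_mul]
    refine Finset.sum_congr rfl fun j _ => ?_
    by_cases hi : k < n i <;> by_cases hj : k < n j <;> simp [hi, hj]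
  simp_rw [hsq]
  rw [Finset.sum_comm]
  refine Finset.sum_congr rfl fun i _ => ?_
  rw [Finset.sum_comm]
  exact Finset.sum_congr rfl fun j _ => sum_ite_lt_mul _ ((min_le_left _ _).trans (h i)) x

lemma abs_activeWeight_le {ι : Type*} [Fintype ι] (c : ι → ℝ) (n : ι → ℕ) (k : ℕ) :
    |activeWeight c n k| ≤ ∑ i, |c i| := by
  refine (Finset.abs_sum_le_sum_abs _ _).trans (Finset.sum_le_sum fun i _ => ?_)
  split_ifs <;> simp

/-- The characteristic function at `w`, minus one, of a variable with value `β` with probability `p`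
and value `α` with probability `1 - p`. -/
noncomputable def stepChar (p α β w : ℝ) : ℂ :=
  (1 - p : ℝ) * (Complex.exp ((w * α : ℝ) * Complex.I) - 1)
    + p * (Complex.exp ((w * β : ℝ) * Complex.I) - 1)

lemma walk_eq_sum_range {Ω : Type*} (X : ℕ → Ω → ℕ) (n : ℕ) (ω : Ω) :
    walk X n ω = ∑ k ∈ Finset.range n, X (k + 1) ω := by
  rw [walk, Finset.range_eq_Ico, Finset.sum_Ico_add' (fun k => X k ω) 0 n 1]
  rfl

namespace IsBernoulliSeq

variable {Ω : Type*} [MeasurableSpace Ω] {θ q : ℝ} {X : ℕ → Ω → ℕ} {P : Measure Ω}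

lemma aemeasurable_log_price (h : IsBernoulliSeq θ q X P) (S₀ a b : ℝ) (n : ℕ) :
    AEMeasurable (fun ω => Real.log (price S₀ a b X n ω)) P := by
  have hw : AEMeasurable (fun ω => walk X n ω) P := by
    simp_rw [walk_eq_sum_range]
    exact Finset.aemeasurable_fun_sum _ fun k _ => h.aemeasurable (k + 1) (by omega)
  exact (measurable_from_top
    (f := fun w : ℕ => Real.log (S₀ * b ^ w * a ^ (n - w)))).comp_aemeasurable hw

variable [IsProbabilityMeasure P]

lemma ae_eq_zero_or_one (h : IsBernoulliSeq θ q X P) (hθ : 0 < θ) (hq : 0 < q) :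
    ∀ᵐ ω ∂P, ∀ k, X (k + 1) ω = 0 ∨ X (k + 1) ω = 1 := by
  rw [ae_all_iff]
  intro k
  have hm := h.aemeasurable (k + 1) (by omega)
  have hx : 0 < θ * q ^ k := by positivity
  have h0 := h.prob_zero (k + 1) (by omega)
  have h1 := h.prob_one (k + 1) (by omega)
  have hd : Disjoint {ω | X (k + 1) ω = 0} {ω | X (k + 1) ω = 1} := by
    rw [Set.disjoint_left]; intro ω h0 h1; simp_all
  have hN : NullMeasurableSet {ω | X (k + 1) ω = 1} P :=
    hm.nullMeasurable (measurableSet_singleton 1)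
  have hN0 : NullMeasurableSet {ω | X (k + 1) ω = 0} P :=
    hm.nullMeasurable (measurableSet_singleton 0)
  -- The two prescribed probabilities add up to `1`, which leaves no mass for other values.
  have hU : P ({ω | X (k + 1) ω = 0} ∪ {ω | X (k + 1) ω = 1}) = 1 := by
    rw [measure_union₀ hN hd.aedisjoint, h0, h1, ← ENNReal.ofReal_add (by positivity)
      (by positivity), ← add_div]
    simp only [Nat.add_sub_cancel]
    rw [div_self (by positivity), ENNReal.ofReal_one]
  exact (prob_compl_eq_zero_iff₀ (hN0.union hN)).2 hU

lemma integral_eq (h : IsBernoulliSeq θ q X P) (hθ : 0 < θ) (hq : 0 < q) (k : ℕ) (f : ℕ → ℂ) :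
    ∫ ω, f (X (k + 1) ω) ∂P
      = (1 - bernoulliProb θ (q ^ k) : ℝ) * f 0 + (bernoulliProb θ (q ^ k) : ℝ) * f 1 := by
  set p : ℝ := bernoulliProb θ (q ^ k) with hp
  have hp0 : 0 ≤ p := by rw [hp, bernoulliProb]; positivity
  have hN : NullMeasurableSet {ω | X (k + 1) ω = 1} P :=
    (h.aemeasurable (k + 1) (by omega)).nullMeasurable (measurableSet_singleton 1)
  -- In this form integrability holds for an arbitrary `f`.
  have hae : (fun ω => f (X (k + 1) ω)) =ᵐ[P]
      fun ω => f 0 + {ω | X (k + 1) ω = 1}.indicator (fun _ => f 1 - f 0) ω := by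
    filter_upwards [h.ae_eq_zero_or_one hθ hq] with ω hω
    rcases hω k with h0 | h1
    · simp [h0]
    · simp [h1]
  have hr : P.real {ω | X (k + 1) ω = 1} = p := by
    rw [measureReal_def, h.prob_one (k + 1) (by omega), Nat.add_sub_cancel]
    exact ENNReal.toReal_ofReal hp0
  rw [integral_congr_ae hae, integral_add (integrable_const _)
    ((integrable_const _).indicator₀ hN), integral_indicator₀ hN, setIntegral_const, hr]
  simp only [integral_const, probReal_univ, one_smul, Complex.real_smul]
  push_cast
  ring

lemma ae_log_price (h : IsBernoulliSeq θ q X P) (hθ : 0 < θ) (hq : 0 < q) {S₀ a b : ℝ}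
    (hS : 0 < S₀) (ha : 0 < a) (hb : 0 < b) :
    ∀ᵐ ω ∂P, ∀ n, Real.log (price S₀ a b X n ω) = Real.log S₀ +
      ∑ k ∈ Finset.range n, if X (k + 1) ω = 1 then Real.log b else Real.log a := by
  filter_upwards [h.ae_eq_zero_or_one hθ hq] with ω hω n
  -- This makes the truncated subtraction in the exponent of `a` a true one.
  have hle : walk X n ω ≤ n := by
    rw [walk_eq_sum_range]
    refine (Finset.sum_le_card_nsmul _ _ 1 fun k _ => ?_).trans (by simp)
    rcases hω k with h | h <;> simp [h]
  have hk : ∀ k, (if X (k + 1) ω = 1 then Real.log b else Real.log a)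
      = (X (k + 1) ω : ℝ) * (Real.log b - Real.log a) + Real.log a := fun k => by
    rcases hω k with h | h <;> simp [h]
  simp_rw [hk]
  rw [Finset.sum_add_distrib, ← Finset.sum_mul, ← Nat.cast_sum, ← walk_eq_sum_range, price,
    Real.log_mul (by positivity) (by positivity), Real.log_mul (by positivity) (by positivity),
    Real.log_pow, Real.log_pow, Nat.cast_sub hle]
  simp only [Finset.sum_const, Finset.card_range, nsmul_eq_mul]
  ring

/-- The characteristic function of the finite-dimensional distributions of the log-price. -/
lemma integral_exp_log_price {ι : Type*} [Fintype ι] (h : IsBernoulliSeq θ q X P) (hθ : 0 < θ)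
    (hq : 0 < q) {S₀ a b : ℝ} (hS : 0 < S₀) (ha : 0 < a) (hb : 0 < b) (c : ι → ℝ) (n : ι → ℕ)
    (N : ℕ) (hn : ∀ i, n i ≤ N) :
    ∫ ω, Complex.exp (((∑ i, c i * Real.log (price S₀ a b X (n i) ω) : ℝ) : ℂ) * Complex.I) ∂P
      = Complex.exp (((∑ i, c i) * Real.log S₀ : ℝ) * Complex.I) *
        ∏ k ∈ Finset.range N, (1 + stepChar (bernoulliProb θ (q ^ k)) (Real.log a) (Real.log b)
          (activeWeight c n k)) := by
  set f : ℕ → ℕ → ℂ := fun k x => Complex.exp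
    ((activeWeight c n k * (if x = 1 then Real.log b else Real.log a) : ℝ) * Complex.I) with hf
  have hae : (fun ω => Complex.exp
      (((∑ i, c i * Real.log (price S₀ a b X (n i) ω) : ℝ) : ℂ) * Complex.I)) =ᵐ[P]
      fun ω => Complex.exp (((∑ i, c i) * Real.log S₀ : ℝ) * Complex.I) *
        ∏ k : Fin N, f k (X (k + 1) ω) := by
    filter_upwards [h.ae_log_price hθ hq hS ha hb] with ω hω
    simp_rw [hω, hf]
    rw [← Complex.exp_sum, ← Complex.exp_add, ← Finset.sum_mul, ← add_mul, ← Complex.ofReal_sum,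
      ← Complex.ofReal_add, Fin.sum_univ_eq_sum_range (fun k => activeWeight c n k *
      (if X (k + 1) ω = 1 then Real.log b else Real.log a)), sum_activeWeight_mul _ _ hn]
    simp_rw [mul_add, Finset.sum_add_distrib, Finset.sum_mul]
  have hind : iIndepFun (fun k : Fin N => X (k + 1)) P :=
    h.indep.precomp Fin.val_injective
  rw [integral_congr_ae hae, integral_const_mul, hind.integral_fun_prod_comp
    (fun k => h.aemeasurable _ (by omega)) (fun k => by fun_prop),
    Fin.prod_univ_eq_prod_range (fun k => ∫ ω, f k (X (k + 1) ω) ∂P)]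
  congr 1
  refine Finset.prod_congr rfl fun k _ => ?_
  rw [h.integral_eq hθ hq, stepChar]
  simp only [hf, zero_ne_one, if_false, if_true]
  push_cast
  ring

end IsBernoulliSeq

/-! ### Uniform asymptotics for triangular arrays -/

/-- The filter on pairs `(N, k)` expressing that `N → ∞`, uniformly in `k < N`. -/
def triangle : Filter (ℕ × ℕ) := comap Prod.fst atTop ⊓ 𝓟 {y | y.2 < y.1}

lemma eventually_triangle {p : ℕ × ℕ → Prop} :
    (∀ᶠ y in triangle, p y) ↔ ∀ᶠ N in atTop, ∀ k < N, p (N, k) := by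
  rw [triangle, eventually_inf_principal, eventually_comap]
  refine eventually_congr (Eventually.of_forall fun N => ⟨fun h k hk => h (N, k) rfl hk, ?_⟩)
  rintro h ⟨N', k⟩ rfl hk
  exact h k hk

lemma tendsto_fst_triangle : Tendsto Prod.fst triangle atTop :=
  tendsto_comap.mono_left inf_le_left

lemma eventually_triangle_lt : ∀ᶠ y in triangle, y.2 < y.1 :=
  eventually_triangle.2 (Eventually.of_forall fun _ _ h => h)

/-- The scale `N ^ (-1/2)`. -/
noncomputable def scale (N : ℕ) : ℝ := (√(N : ℝ))⁻¹

lemma scale_sq (N : ℕ) : scale N ^ 2 = (N : ℝ)⁻¹ := by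
  rw [scale, inv_pow, Real.sq_sqrt (Nat.cast_nonneg N)]

lemma tendsto_scale : Tendsto scale atTop (𝓝 0) :=
  tendsto_inv_atTop_zero.comp (Real.tendsto_sqrt_atTop.comp tendsto_natCast_atTop_atTop)

lemma scale_isLittleO_one : scale =o[atTop] fun _ => (1 : ℝ) :=
  (isLittleO_one_iff ℝ).2 tendsto_scale

lemma scale_triangle_isLittleO_one :
    (fun y : ℕ × ℕ => scale y.1) =o[triangle] fun _ => (1 : ℝ) :=
  scale_isLittleO_one.comp_tendsto tendsto_fst_triangle

/-- There are at most `N` terms, each `o(1/N)` uniformly in `k`. -/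
lemma tendsto_sum_range_of_isLittleO {E : Type*} [NormedAddCommGroup E] {e : ℕ × ℕ → E}
    (he : e =o[triangle] fun y => scale y.1 ^ 2) {n : ℕ → ℕ} (hn : ∀ N, n N ≤ N) :
    Tendsto (fun N => ∑ k ∈ Finset.range (n N), e (N, k)) atTop (𝓝 0) := by
  rw [Metric.tendsto_nhds]
  intro ε hε
  have h1 := eventually_triangle.1 (he.def (half_pos hε))
  filter_upwards [h1, eventually_gt_atTop 0] with N hN hpos
  rw [dist_zero_right]
  have hN' : (0 : ℝ) < N := by exact_mod_cast hpos
  have hs : (n N : ℝ) * (ε / 2 * (N : ℝ)⁻¹) ≤ ε / 2 := by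
    have : (n N : ℝ) ≤ N := by exact_mod_cast hn N
    calc (n N : ℝ) * (ε / 2 * (N : ℝ)⁻¹) ≤ N * (ε / 2 * (N : ℝ)⁻¹) := by gcongr
      _ = ε / 2 := by field_simp
  calc ‖∑ k ∈ Finset.range (n N), e (N, k)‖
      ≤ ∑ k ∈ Finset.range (n N), ε / 2 * (N : ℝ)⁻¹ := by
        refine norm_sum_le_of_le _ fun k hk => ?_
        have := hN k ((Finset.mem_range.1 hk).trans_le (hn N))
        simpa [scale_sq] using this
    _ ≤ ε / 2 := by simpa using hs
    _ < ε := half_lt_self hε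

/-- The main part is a Riemann sum of `M + D x` over `[0, τ]`. -/
lemma tendsto_sum_range_of_affine {x : ℕ × ℕ → ℝ} {M D τ : ℝ}
    (hx : (fun y => x y - (M + D * (y.2 * scale y.1 ^ 2)) * scale y.1 ^ 2)
      =o[triangle] fun y => scale y.1 ^ 2)
    {n : ℕ → ℕ} (hn : ∀ N, n N ≤ N) (hτ : Tendsto (fun N => (n N : ℝ) / N) atTop (𝓝 τ)) :
    Tendsto (fun N => ∑ k ∈ Finset.range (n N), x (N, k)) atTop (𝓝 (M * τ + D * τ ^ 2 / 2)) := by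
  have h0 := tendsto_sum_range_of_isLittleO hx hn
  -- The correction `- N⁻¹` comes from `∑ k < n, k = n (n - 1) / 2`.
  have h1 : Tendsto (fun N : ℕ => M * ((n N : ℝ) / N)
      + D * ((n N : ℝ) / N) * ((n N : ℝ) / N - (N : ℝ)⁻¹) / 2) atTop
      (𝓝 (M * τ + D * τ * (τ - 0) / 2)) :=
    (hτ.const_mul M).add (((hτ.const_mul D).mul
      (hτ.sub tendsto_inv_atTop_nhds_zero_nat)).div_const 2)
  have h2 := h0.add h1
  have hlim : 0 + (M * τ + D * τ * (τ - 0) / 2) = M * τ + D * τ ^ 2 / 2 := by ring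
  rw [hlim] at h2
  refine h2.congr fun N => ?_
  have hg : ∀ m : ℕ, ∑ k ∈ Finset.range m, (k : ℝ) = m * (m - 1) / 2 := fun m => by
    induction m with
    | zero => simp
    | succ m ih => rw [Finset.sum_range_succ, ih]; push_cast; ring
  have he : ∑ k ∈ Finset.range (n N), (M + D * ((k : ℝ) * scale N ^ 2)) * scale N ^ 2
      = M * ((n N : ℝ) / N) + D * ((n N : ℝ) / N) * ((n N : ℝ) / N - (N : ℝ)⁻¹) / 2 := by
    rw [← Finset.sum_mul, Finset.sum_add_distrib, ← Finset.mul_sum, ← Finset.sum_mul, hg, scale_sq]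
    simp only [Finset.sum_const, Finset.card_range, nsmul_eq_mul]
    ring
  rw [← he, Finset.sum_sub_distrib]
  ring

/-- Replacing `log (1 + z)` by `z` costs `O(z ^ 2)`, which is `o(1/N)` uniformly and so disappears
in the sum. The branch of the logarithm is immaterial, since it is exponentiated again. -/
lemma tendsto_prod_one_add {z : ℕ × ℕ → ℂ} {ℓ : ℂ}
    (hz : z =O[triangle] fun y => scale y.1 ^ 2)
    (hsum : Tendsto (fun N => ∑ k ∈ Finset.range N, z (N, k)) atTop (𝓝 ℓ)) :
    Tendsto (fun N => ∏ k ∈ Finset.range N, (1 + z (N, k))) atTop (𝓝 (Complex.exp ℓ)) := by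
  have hs2 : (fun y : ℕ × ℕ => scale y.1 ^ 2) =o[triangle] fun _ => (1 : ℝ) := by
    simpa using scale_triangle_isLittleO_one.pow (n := 2) (by norm_num)
  have hz0 : Tendsto z triangle (𝓝 0) := (isLittleO_one_iff ℝ).1 (hz.trans_isLittleO hs2)
  have hsmall : ∀ᶠ y in triangle, ‖z y‖ < 1 / 2 := by
    have := hz0.norm
    rw [norm_zero] at this
    exact this.eventually (gt_mem_nhds (by norm_num))
  have hlog : (fun y => Complex.log (1 + z y) - z y) =O[triangle] fun y => z y ^ 2 := by
    refine IsBigO.of_bound 1 ?_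
    filter_upwards [hsmall] with y hy
    refine (Complex.norm_log_one_add_sub_self_le (hy.trans (by norm_num))).trans ?_
    have : (1 - ‖z y‖)⁻¹ ≤ 2 := by
      rw [inv_le_comm₀ (by linarith) (by norm_num)]
      linarith
    rw [norm_pow]
    nlinarith [sq_nonneg ‖z y‖]
  have hlogo : (fun y => Complex.log (1 + z y) - z y) =o[triangle] fun y => scale y.1 ^ 2 := by
    refine hlog.trans_isLittleO ?_
    simpa [sq] using ((isLittleO_one_iff ℝ).2 hz0).mul_isBigO hz
  have hS := (tendsto_sum_range_of_isLittleO hlogo (fun N => le_refl N)).add hsum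
  rw [zero_add] at hS
  refine (Complex.continuous_exp.continuousAt.tendsto.comp hS).congr' ?_
  filter_upwards [eventually_triangle.1 hsmall] with N hN
  simp only [Function.comp]
  rw [← Finset.sum_add_distrib, Complex.exp_sum]
  refine Finset.prod_congr rfl fun k hk => ?_
  rw [sub_add_cancel, Complex.exp_log]
  intro h0
  have h1 := hN k (Finset.mem_range.1 hk)
  rw [show z (N, k) = -1 by linear_combination h0] at h1
  norm_num at h1

/-! ### Expansion of a single step and limit of the product -/

lemma exp_mul_I_expansion :
    (fun x : ℝ => Complex.exp ((x : ℂ) * Complex.I) - 1 - (x * Complex.I - x ^ 2 / 2))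
      =O[𝓝 0] fun x => x ^ 3 := by
  refine IsBigO.of_bound (Real.exp 1) ?_
  have : ∀ᶠ x : ℝ in 𝓝 0, |x| < 1 := by
    have := (continuous_abs (G := ℝ)).tendsto 0
    rw [abs_zero] at this
    exact this.eventually (gt_mem_nhds one_pos)
  filter_upwards [this] with x hx
  have h := Complex.norm_exp_sub_sum_le_norm_mul_exp ((x : ℂ) * Complex.I) 3
  have hn : ‖(x : ℂ) * Complex.I‖ = |x| := by simp
  rw [hn] at h
  have he : Complex.exp ((x : ℂ) * Complex.I) - 1 - (x * Complex.I - x ^ 2 / 2)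
      = Complex.exp ((x : ℂ) * Complex.I)
        - ∑ m ∈ Finset.range 3, ((x : ℂ) * Complex.I) ^ m / (m.factorial : ℂ) := by
    simp only [Finset.sum_range_succ, Finset.sum_range_zero, mul_pow, Complex.I_sq]
    norm_num [Nat.factorial]
    ring
  rw [he, norm_pow, Real.norm_eq_abs, mul_comm (Real.exp 1)]
  refine h.trans ?_
  gcongr

/-- The expansion of `stepChar` in terms of the first two moments. -/
lemma stepChar_expansion {ι : Type*} {l : Filter ι} {p α β w s : ι → ℝ}
    (hp : p =O[l] fun _ => (1 : ℝ)) (hw : w =O[l] fun _ => (1 : ℝ)) (hα : α =O[l] s)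
    (hβ : β =O[l] s) (hs : Tendsto s l (𝓝 0)) :
    (fun y => stepChar (p y) (α y) (β y) (w y)
      - (((w y * ((1 - p y) * α y + p y * β y) : ℝ) : ℂ) * Complex.I
        - ((w y ^ 2 * ((1 - p y) * α y ^ 2 + p y * β y ^ 2) : ℝ) : ℂ) / 2))
      =o[l] fun y => s y ^ 2 := by
  have key : ∀ γ : ι → ℝ, γ =O[l] s →
      (fun y => Complex.exp (((w y * γ y : ℝ) : ℂ) * Complex.I) - 1
        - (((w y * γ y : ℝ) : ℂ) * Complex.I - ((w y * γ y : ℝ) : ℂ) ^ 2 / 2))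
        =o[l] fun y => s y ^ 2 := by
    intro γ hγ
    have h1 : (fun y => w y * γ y) =O[l] s := by simpa using hw.mul hγ
    have h0 : Tendsto (fun y => w y * γ y) l (𝓝 0) := h1.trans_tendsto hs
    refine ((exp_mul_I_expansion.comp_tendsto h0).trans (h1.pow 3)).trans_isLittleO ?_
    exact ((isBigO_refl (fun y => s y ^ 2) l).mul_isLittleO ((isLittleO_one_iff ℝ).2 hs)).congr
      (fun _ => by ring) (fun _ => by ring)
  have hp' : (fun y => ((p y : ℝ) : ℂ)) =O[l] fun _ => (1 : ℝ) := by
    simpa using Complex.isBigO_ofReal_left.2 hp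
  have hp1 : (fun y => ((1 - p y : ℝ) : ℂ)) =O[l] fun _ => (1 : ℝ) :=
    Complex.isBigO_ofReal_left.2 ((isBigO_refl _ l).sub hp)
  have := (hp1.mul_isLittleO (key α hα)).add (hp'.mul_isLittleO (key β hβ))
  simp only [one_mul] at this
  refine this.congr_left fun y => ?_
  rw [stepChar]
  push_cast
  ring

lemma hasDerivAt_bernoulliProb_exp {θ : ℝ} (hθ : 0 < θ) :
    HasDerivAt (fun x => bernoulliProb θ (Real.exp x)) (θ / (1 + θ) ^ 2) 0 := by
  have h1 : HasDerivAt (fun x => θ * Real.exp x) θ 0 := by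
    simpa using (Real.hasDerivAt_exp 0).const_mul θ
  have h2 := h1.div (h1.const_add 1) (by positivity)
  have he : (θ * (1 + θ * Real.exp 0) - θ * Real.exp 0 * θ) / (1 + θ * Real.exp 0) ^ 2
      = θ / (1 + θ) ^ 2 := by
    rw [Real.exp_zero]; ring
  rw [he] at h2
  exact h2

lemma isBigO_index : (fun y : ℕ × ℕ => (y.2 : ℝ) * scale y.1 ^ 2) =O[triangle] fun _ => (1 : ℝ) := by
  refine IsBigO.of_bound 1 ?_
  filter_upwards [eventually_triangle_lt] with y hy
  have h0 : (0 : ℝ) < y.1 := by exact_mod_cast (Nat.zero_le _).trans_lt hy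
  have h1 : (y.2 : ℝ) ≤ y.1 := by exact_mod_cast hy.le
  rw [scale_sq, ← div_eq_mul_inv, Real.norm_of_nonneg (by positivity)]
  simpa using div_le_one_of_le₀ h1 h0.le

/-- Write `q ^ k = exp (k log q)`, where `k log q` is `lam (k/N) N ^ (-1/2)` up to a uniform `o(N ^
(-1/2))`, and differentiate the success probability in the exponent at `0`. -/
lemma bernoulliProb_expansion {θ : ℝ} (hθ : 0 < θ) {q : ℕ → ℝ} (hq : ∀ N, 0 < q N) {lam : ℝ}
    (hlog : (fun N => Real.log (q N) - lam * scale N ^ 3) =o[atTop] fun N => scale N ^ 3) :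
    (fun y : ℕ × ℕ => bernoulliProb θ (q y.1 ^ y.2) - bernoulliProb θ 1
      - θ / (1 + θ) ^ 2 * lam * (y.2 * scale y.1 ^ 2) * scale y.1)
      =o[triangle] fun y => scale y.1 := by
  have hx : (fun y : ℕ × ℕ => y.2 * Real.log (q y.1) - lam * (y.2 * scale y.1 ^ 2) * scale y.1)
      =o[triangle] fun y => scale y.1 := by
    -- As `k ≤ N`, multiplying the error `o(scale ^ 3)` of `log q` by `k` leaves `o(scale)`.
    have hk : (fun y : ℕ × ℕ => (y.2 : ℝ)) =O[triangle] fun y => (scale y.1 ^ 2)⁻¹ := by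
      refine IsBigO.of_bound 1 ?_
      filter_upwards [eventually_triangle_lt] with y hy
      rw [scale_sq, inv_inv, one_mul, Real.norm_natCast, Real.norm_natCast]
      exact_mod_cast hy.le
    refine (hk.mul_isLittleO (hlog.comp_tendsto tendsto_fst_triangle)).congr' ?_ ?_
    · exact Eventually.of_forall fun y => by simp only [Function.comp]; ring
    · filter_upwards [eventually_triangle_lt] with y hy
      have hs : scale y.1 ≠ 0 := by
        have : (0 : ℝ) < y.1 := by exact_mod_cast (Nat.zero_le _).trans_lt hy
        rw [scale]
        positivity
      simp only [Function.comp]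
      field_simp
  have hxO : (fun y : ℕ × ℕ => y.2 * Real.log (q y.1)) =O[triangle] fun y => scale y.1 := by
    have h1 : (fun y : ℕ × ℕ => lam * (y.2 * scale y.1 ^ 2) * scale y.1) =O[triangle]
        fun y => scale y.1 := by
      simpa using (isBigO_index.const_mul_left lam).mul
        (isBigO_refl (fun y : ℕ × ℕ => scale y.1) triangle)
    simpa using hx.isBigO.add h1
  have hx0 : Tendsto (fun y : ℕ × ℕ => y.2 * Real.log (q y.1)) triangle (𝓝 0) :=
    hxO.trans_tendsto (tendsto_scale.comp tendsto_fst_triangle)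
  have hd := (hasDerivAt_iff_isLittleO.1 (hasDerivAt_bernoulliProb_exp hθ)).comp_tendsto hx0
  have hd' := hd.trans_isBigO (k := fun y : ℕ × ℕ => scale y.1)
    (by simpa [Function.comp_def] using hxO)
  refine (hd'.add (hx.const_mul_left (θ / (1 + θ) ^ 2))).congr_left fun y => ?_
  have hqe : Real.exp (y.2 * Real.log (q y.1)) = q y.1 ^ y.2 := by
    rw [Real.exp_nat_mul, Real.exp_log (hq _)]
  simp only [Function.comp, hqe, Real.exp_zero, smul_eq_mul, sub_zero]
  ring

/-- Hypothesis `hM` encodes the cancellation of the `N ^ (-1/2)` mean at the unperturbed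
probability. The tilt of that probability adds a mean affine in `k/N`, whence `τ ^ 2 / 2`. -/
theorem tendsto_prod_stepChar {ι : Type*} [Fintype ι] {θ : ℝ} (hθ : 0 < θ) {q α β : ℕ → ℝ}
    (hq : ∀ N, 0 < q N) {lam A B M : ℝ}
    (hlog : (fun N => Real.log (q N) - lam * scale N ^ 3) =o[atTop] fun N => scale N ^ 3)
    (hα : (fun N => α N - A * scale N) =o[atTop] scale)
    (hβ : (fun N => β N - B * scale N) =o[atTop] scale)
    (hM : (fun N => (1 - bernoulliProb θ 1) * α N + bernoulliProb θ 1 * β N - M * scale N ^ 2)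
      =o[atTop] fun N => scale N ^ 2)
    (c : ι → ℝ) (n : ι → ℕ → ℕ) (hn : ∀ i N, n i N ≤ N) (τ : ι → ℝ)
    (hτ : ∀ i, Tendsto (fun N => (n i N : ℝ) / N) atTop (𝓝 (τ i))) :
    Tendsto (fun N => ∏ k ∈ Finset.range N, (1 + stepChar (bernoulliProb θ (q N ^ k)) (α N) (β N)
        (activeWeight c (fun i => n i N) k))) atTop
      (𝓝 (Complex.exp
        (((∑ i, c i * (M * τ i + θ / (1 + θ) ^ 2 * lam * (B - A) * τ i ^ 2 / 2) : ℝ) : ℂ)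
            * Complex.I
          - ((∑ i, ∑ j, c i * c j * (((1 - bernoulliProb θ 1) * A ^ 2 + bernoulliProb θ 1 * B ^ 2)
            * min (τ i) (τ j)) : ℝ) : ℂ) / 2))) := by
  set p₀ := bernoulliProb θ 1
  set κ := θ / (1 + θ) ^ 2
  set V := (1 - p₀) * A ^ 2 + p₀ * B ^ 2 with hV
  set p : ℕ × ℕ → ℝ := fun y => bernoulliProb θ (q y.1 ^ y.2) with hp
  set w : ℕ × ℕ → ℝ := fun y => activeWeight c (fun i => n i y.1) y.2 with hw
  set s : ℕ × ℕ → ℝ := fun y => scale y.1 with hs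
  set m : ℕ × ℕ → ℝ := fun y => (1 - p y) * α y.1 + p y * β y.1 with hm
  set v : ℕ × ℕ → ℝ := fun y => (1 - p y) * α y.1 ^ 2 + p y * β y.1 ^ 2 with hv
  have hs0 : Tendsto s triangle (𝓝 0) := tendsto_scale.comp tendsto_fst_triangle
  have hα' : (fun y : ℕ × ℕ => α y.1 - A * s y) =o[triangle] s :=
    hα.comp_tendsto tendsto_fst_triangle
  have hβ' : (fun y : ℕ × ℕ => β y.1 - B * s y) =o[triangle] s :=
    hβ.comp_tendsto tendsto_fst_triangle
  have hαO : (fun y : ℕ × ℕ => α y.1) =O[triangle] s := by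
    simpa using hα'.isBigO.add ((isBigO_refl s triangle).const_mul_left A)
  have hβO : (fun y : ℕ × ℕ => β y.1) =O[triangle] s := by
    simpa using hβ'.isBigO.add ((isBigO_refl s triangle).const_mul_left B)
  have hp1 : (fun y => p y - p₀ - κ * lam * (y.2 * s y ^ 2) * s y) =o[triangle] s :=
    bernoulliProb_expansion hθ hq hlog
  have hlin : (fun y : ℕ × ℕ => κ * lam * (y.2 * s y ^ 2) * s y) =O[triangle] s := by
    simpa using (isBigO_index.const_mul_left (κ * lam)).mul (isBigO_refl s triangle)
  have hδ : (fun y => p y - p₀) =O[triangle] s := by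
    simpa using hp1.isBigO.add hlin
  have hso : s =o[triangle] fun _ => (1 : ℝ) := scale_triangle_isLittleO_one
  have hpO : p =O[triangle] fun _ => (1 : ℝ) := by
    have := (hδ.trans_isLittleO hso).isBigO.add (isBigO_const_const p₀ one_ne_zero triangle)
    simpa using this
  have hwO : w =O[triangle] fun _ => (1 : ℝ) :=
    IsBigO.of_bound (∑ i, |c i|) (Eventually.of_forall fun y => by
      simpa using abs_activeWeight_le c (fun i => n i y.1) y.2)
  -- The mean is its value at `p₀` plus `(p - p₀) (β - α)`: `e2` linearises `p - p₀`, then `e3`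
  -- linearises `β - α`.
  have hmo : (fun y => m y - (M + κ * lam * (B - A) * (y.2 * s y ^ 2)) * s y ^ 2)
      =o[triangle] fun y => s y ^ 2 := by
    have e1 := hM.comp_tendsto tendsto_fst_triangle
    have e2 : (fun y => (p y - p₀ - κ * lam * (y.2 * s y ^ 2) * s y) * (β y.1 - α y.1))
        =o[triangle] fun y => s y * s y := hp1.mul_isBigO (hβO.sub hαO)
    have e3 : (fun y : ℕ × ℕ => κ * lam * (y.2 * s y ^ 2) * s y *
        ((β y.1 - B * s y) - (α y.1 - A * s y))) =o[triangle] fun y => s y * s y :=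
      hlin.mul_isLittleO (hβ'.sub hα')
    simp only [← sq] at e2 e3
    refine ((e1.add e2).add e3).congr_left fun y => ?_
    simp only [Function.comp, hm, hs]
    ring
  -- The slope is `0`: the squared jumps are already `O(1/N)`, so a change `o(1)` of `p` is
  -- negligible.
  have hvo : (fun y => v y - (V + 0 * (y.2 * s y ^ 2)) * s y ^ 2)
      =o[triangle] fun y => s y ^ 2 := by
    have hsq : ∀ (γ : ℕ × ℕ → ℝ) (C : ℝ), (fun y => γ y - C * s y) =o[triangle] s →
        γ =O[triangle] s → (fun y => γ y ^ 2 - C ^ 2 * s y ^ 2) =o[triangle] fun y => s y ^ 2 := by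
      intro γ C h1 h2
      have := h1.mul_isBigO (h2.add ((isBigO_refl s triangle).const_mul_left C))
      exact this.congr (fun y => by ring) (fun y => by ring)
    have e1 := (hsq _ A hα' hαO).const_mul_left (1 - p₀)
    have e2 := (hsq _ B hβ' hβO).const_mul_left p₀
    have e3 : (fun y => (p y - p₀) * (β y.1 ^ 2 - α y.1 ^ 2)) =o[triangle] fun y => 1 * s y ^ 2 :=
      (hδ.trans_isLittleO hso).mul_isBigO ((hβO.pow 2).sub (hαO.pow 2))
    simp only [one_mul] at e3
    refine ((e1.add e2).add e3).congr_left fun y => ?_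
    simp only [hv, hV]
    ring
  have hcoef : ∀ C D : ℝ, (fun y : ℕ × ℕ => (C + D * (y.2 * s y ^ 2)) * s y ^ 2)
      =O[triangle] fun y => s y ^ 2 := fun C D => by
    simpa using ((isBigO_const_const C one_ne_zero triangle).add
      (isBigO_index.const_mul_left D)).mul (isBigO_refl (fun y => s y ^ 2) triangle)
  have hmO : m =O[triangle] fun y => s y ^ 2 := by
    simpa using hmo.isBigO.add (hcoef M (κ * lam * (B - A)))
  have hvO : v =O[triangle] fun y => s y ^ 2 := by
    simpa only [sub_add_cancel] using hvo.isBigO.add (hcoef V 0)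
  have hexp := stepChar_expansion (l := triangle) hpO hwO hαO hβO hs0
  have hmainO : (fun y => ((w y * m y : ℝ) : ℂ) * Complex.I - ((w y ^ 2 * v y : ℝ) : ℂ) / 2)
      =O[triangle] fun y => s y ^ 2 := by
    have h1 : (fun y => ((w y * m y : ℝ) : ℂ)) =O[triangle] fun y => s y ^ 2 :=
      Complex.isBigO_ofReal_left.2 (by simpa using hwO.mul hmO)
    have h2 : (fun y => ((w y ^ 2 * v y : ℝ) : ℂ)) =O[triangle] fun y => s y ^ 2 :=
      Complex.isBigO_ofReal_left.2 (by simpa using (hwO.pow 2).mul hvO)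
    refine ((h1.const_mul_left Complex.I).sub (h2.const_mul_left (1 / 2))).congr_left fun y => ?_
    ring
  refine tendsto_prod_one_add (z := fun y => stepChar (p y) (α y.1) (β y.1) (w y)) ?_ ?_
  · exact (hexp.isBigO.add hmainO).congr_left fun y => sub_add_cancel _ _
  have hsum0 := tendsto_sum_range_of_isLittleO hexp (fun N => le_refl N)
  have hsum1 : Tendsto (fun N => ∑ k ∈ Finset.range N, w (N, k) * m (N, k)) atTop
      (𝓝 (∑ i, c i * (M * τ i + κ * lam * (B - A) * τ i ^ 2 / 2))) := by
    refine (tendsto_finsetSum _ fun i _ =>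
      (tendsto_sum_range_of_affine hmo (hn i) (hτ i)).const_mul (c i)).congr fun N => ?_
    exact (sum_activeWeight_mul c (fun i => n i N) (fun i => hn i N) fun k => m (N, k)).symm
  have hsum2 : Tendsto (fun N => ∑ k ∈ Finset.range N, w (N, k) ^ 2 * v (N, k)) atTop
      (𝓝 (∑ i, ∑ j, c i * c j * (V * min (τ i) (τ j)))) := by
    have hmin : ∀ i j, Tendsto (fun N => ((min (n i N) (n j N) : ℕ) : ℝ) / N) atTop
        (𝓝 (min (τ i) (τ j))) := fun i j => by
      refine ((hτ i).min (hτ j)).congr fun N => ?_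
      rw [Nat.cast_min, min_div_div_right (Nat.cast_nonneg N)]
    have := tendsto_finsetSum Finset.univ fun i _ => tendsto_finsetSum Finset.univ fun j _ =>
      (tendsto_sum_range_of_affine hvo (fun N => (min_le_left _ (n j N)).trans (hn i N))
        (hmin i j)).const_mul (c i * c j)
    simp only [zero_mul, zero_div, add_zero] at this
    refine this.congr fun N => ?_
    exact (sum_activeWeight_sq_mul c (fun i => n i N) (fun i => hn i N) fun k => v (N, k)).symm
  have hsum1' := (Complex.continuous_ofReal.tendsto _).comp hsum1
  have hsum2' := (Complex.continuous_ofReal.tendsto _).comp hsum2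
  have := hsum0.add ((hsum1'.mul_const Complex.I).sub (hsum2'.div_const 2))
  rw [zero_add] at this
  refine this.congr fun N => ?_
  simp only [Function.comp, Complex.ofReal_sum]
  rw [Finset.sum_mul, Finset.sum_div, ← Finset.sum_sub_distrib, ← Finset.sum_add_distrib]
  exact Finset.sum_congr rfl fun k _ => sub_add_cancel _ _

/-! ### Logarithms of the parameters -/

/-- The second-order expansion of the logarithm along `1 + C N ^ (-1/2) + D N ^ (-1)`. -/
lemma log_expansion {a : ℕ → ℝ} {C D : ℝ}
    (ha : (fun N => a N - (1 + C * scale N + D * scale N ^ 2)) =o[atTop] fun N => scale N ^ 2) :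
    Tendsto a atTop (𝓝 1) ∧
    (fun N => Real.log (a N) - (C * scale N + (D - C ^ 2 / 2) * scale N ^ 2))
      =o[atTop] fun N => scale N ^ 2 := by
  have hs2 : (fun N => scale N ^ 2) =o[atTop] scale := by
    simpa [sq] using (isBigO_refl scale atTop).mul_isLittleO scale_isLittleO_one
  have hx1 : (fun N => a N - 1 - C * scale N) =o[atTop] scale := by
    refine ((ha.trans hs2).add (hs2.const_mul_left D)).congr_left fun N => ?_
    ring
  have hxO : (fun N => a N - 1) =O[atTop] scale := by
    simpa using hx1.isBigO.add ((isBigO_refl scale atTop).const_mul_left C)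
  have hx0 : Tendsto (fun N => a N - 1) atTop (𝓝 0) := hxO.trans_tendsto tendsto_scale
  refine ⟨by simpa using hx0.add_const 1, ?_⟩
  have hlog : (fun N => Real.log (a N) - ((a N - 1) - (a N - 1) ^ 2 / 2))
      =o[atTop] fun N => scale N ^ 2 := by
    have h3 : (fun N => Real.log (a N) - ((a N - 1) - (a N - 1) ^ 2 / 2))
        =O[atTop] fun N => (a N - 1) ^ 3 := by
      -- The Taylor remainder is at most `|x| ^ 3 / (1 - |x|)`, and `|x| < 1/2`.
      refine IsBigO.of_bound 2 ?_
      have hsmall : ∀ᶠ N in atTop, |a N - 1| < 1 / 2 := by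
        have := hx0.abs
        rw [abs_zero] at this
        exact this.eventually (gt_mem_nhds (by norm_num))
      filter_upwards [hsmall] with N hN
      have hN' : |1 - a N| < 1 / 2 := by rwa [abs_sub_comm]
      have h := Real.abs_log_sub_add_sum_range_le (hN'.trans (by norm_num)) 2
      have he : (∑ i ∈ Finset.range 2, (1 - a N) ^ (i + 1) / ((i : ℝ) + 1)) + Real.log (1 - (1 - a N))
          = Real.log (a N) - ((a N - 1) - (a N - 1) ^ 2 / 2) := by
        simp only [Finset.sum_range_succ, Finset.sum_range_zero, sub_sub_cancel]
        push_cast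
        ring
      rw [he, abs_sub_comm 1] at h
      rw [Real.norm_eq_abs, Real.norm_eq_abs, abs_pow]
      refine h.trans ?_
      rw [div_le_iff₀ (by linarith)]
      have h3 : |a N - 1| ^ (2 + 1) = |a N - 1| ^ 3 := rfl
      nlinarith [mul_nonneg (pow_nonneg (abs_nonneg (a N - 1)) 3)
        (by linarith : 0 ≤ 1 / 2 - |a N - 1|)]
    refine (h3.trans (hxO.pow 3)).trans_isLittleO ?_
    exact ((isBigO_refl (fun N => scale N ^ 2) atTop).mul_isLittleO scale_isLittleO_one).congr
      (fun _ => by ring) (fun _ => by ring)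
  have hsq : (fun N => (a N - 1) ^ 2 - C ^ 2 * scale N ^ 2) =o[atTop] fun N => scale N ^ 2 := by
    have := hx1.mul_isBigO (hxO.add ((isBigO_refl scale atTop).const_mul_left C))
    exact this.congr (fun y => by ring) (fun y => by ring)
  refine ((hlog.add ha).sub (hsq.const_mul_left (1 / 2))).congr_left fun N => ?_
  ring

lemma rpow_three_halves {x : ℝ} (hx : 0 ≤ x) : x ^ (3 / 2 : ℝ) = √x ^ 3 := by
  rw [Real.sqrt_eq_rpow, ← Real.rpow_natCast, ← Real.rpow_mul hx]
  norm_num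

/-- First order suffices: `q - 1` is `O(scale ^ 3)`, so the differentiability of `log` at `1` leaves
an error `o(scale ^ 3)`. -/
lemma log_expansion_of_cube {q : ℕ → ℝ} {lam : ℝ}
    (hq : (fun N => q N - (1 + lam * scale N ^ 3)) =o[atTop] fun N => scale N ^ 3) :
    (fun N => Real.log (q N) - lam * scale N ^ 3) =o[atTop] fun N => scale N ^ 3 := by
  have hxO : (fun N => q N - 1) =O[atTop] fun N => scale N ^ 3 := by
    have := hq.isBigO.add ((isBigO_refl (fun N => scale N ^ 3) atTop).const_mul_left lam)
    refine this.congr_left fun N => ?_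
    ring
  have hs3 : Tendsto (fun N => scale N ^ 3) atTop (𝓝 0) := by
    simpa using tendsto_scale.pow 3
  have hq1 : Tendsto q atTop (𝓝 1) := by
    simpa using (hxO.trans_tendsto hs3).add_const 1
  have hd := (hasDerivAt_iff_isLittleO.1 (Real.hasDerivAt_log one_ne_zero)).comp_tendsto hq1
  have hd' := hd.trans_isBigO (k := fun N => scale N ^ 3) (by simpa [Function.comp_def] using hxO)
  refine (hd'.add hq).congr_left fun N => ?_
  simp only [Function.comp, Real.log_one, inv_one, smul_eq_mul]
  ring

end QBinomial

/-! ### Identification of the limit -/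

theorem proposition3
    {Ω : ℕ → Type*} [∀ N, MeasurableSpace (Ω N)]
    (P : (N : ℕ) → Measure (Ω N)) [∀ N, IsProbabilityMeasure (P N)]
    {Ω' : Type*} [MeasurableSpace Ω'] (P' : Measure Ω') [IsProbabilityMeasure P']
    (T σ θ S₀ η ζ : ℝ) (hT : 0 < T) (hσ : 0 < σ) (hθ : 0 < θ) (hS₀ : 0 < S₀)
    (a b q : ℕ → ℝ)
    (ha : (fun N : ℕ => a N -
        (1 - σ * √(θ * (T / N)) + ζ * (σ ^ 2 / 2) * θ * (T / N)))
      =o[atTop] fun N : ℕ => (N : ℝ)⁻¹)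
    (hb : (fun N : ℕ => b N -
        (1 + σ * √((T / N) / θ) + ζ * (σ ^ 2 / (2 * θ)) * (T / N)))
      =o[atTop] fun N : ℕ => (N : ℝ)⁻¹)
    (hq_pos : ∀ N, 0 < q N)
    (hq : (fun N : ℕ => q N - (1 + η * (T / N) ^ (3 / 2 : ℝ)))
      =o[atTop] fun N : ℕ => (N : ℝ) ^ (-(3 / 2) : ℝ))
    (X : (N : ℕ) → ℕ → Ω N → ℕ)
    (hX : ∀ N, QBinomial.IsBernoulliSeq θ (q N) (X N) (P N))
    (B : ℝ≥0 → Ω' → ℝ) (hB : IsBrownianReal B P') :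
    QBinomial.TendstoFdd
      (fun (N : ℕ) (t : Set.Icc (0 : ℝ) T) (ω : Ω N) =>
        Real.log (QBinomial.price S₀ (a N) (b N) (X N) ⌊(N : ℝ) * t / T⌋₊ ω))
      (fun (t : Set.Icc (0 : ℝ) T) (ω : Ω') =>
        Real.log S₀ + σ * η * √θ / (2 * (1 + θ)) * (t : ℝ) ^ 2
          - (1 - ζ) * (σ ^ 2 / 2) * t + σ * B (⟨(t : ℝ), t.2.1⟩ : ℝ≥0) ω)
      P P' := by
  intro p t
  have hT0 : √T ≠ 0 := by positivity
  have hθ0 : √θ ≠ 0 := by positivity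
  -- With `T` and `θ` written as squares, all coefficients become rational in `√T` and `√θ`.
  have hTsq : T = √T ^ 2 := (Real.sq_sqrt hT.le).symm
  have hθsq : θ = √θ ^ 2 := (Real.sq_sqrt hθ.le).symm
  have hdiv : ∀ N : ℕ, T / N = (√T * QBinomial.scale N) ^ 2 := fun N => by
    rw [mul_pow, QBinomial.scale_sq, ← hTsq, div_eq_mul_inv]
  have hsc : ∀ N : ℕ, 0 ≤ √T * QBinomial.scale N := fun N => by
    rw [QBinomial.scale]; positivity
  obtain ⟨ha1, ha2⟩ := QBinomial.log_expansion (a := a) (C := -(σ * √θ * √T))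
      (D := ζ * σ ^ 2 / 2 * √θ ^ 2 * √T ^ 2) (by
    refine ha.congr (fun N => ?_) fun N => (QBinomial.scale_sq N).symm
    rw [hdiv, Real.sqrt_mul hθ.le, Real.sqrt_sq (hsc N), Real.sq_sqrt hθ.le]
    ring)
  obtain ⟨hb1, hb2⟩ := QBinomial.log_expansion (a := b) (C := σ * √T / √θ)
      (D := ζ * σ ^ 2 / (2 * √θ ^ 2) * √T ^ 2) (by
    refine hb.congr (fun N => ?_) fun N => (QBinomial.scale_sq N).symm
    rw [hdiv, Real.sqrt_div' _ hθ.le, Real.sqrt_sq (hsc N), Real.sq_sqrt hθ.le]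
    ring)
  have hq2 := QBinomial.log_expansion_of_cube (q := q) (lam := η * √T ^ 3) (by
    refine hq.congr (fun N => ?_) fun N => ?_
    · rw [hdiv, QBinomial.rpow_three_halves (sq_nonneg _), Real.sqrt_sq (hsc N)]
      ring
    · rw [Real.rpow_neg (Nat.cast_nonneg N), QBinomial.rpow_three_halves (Nat.cast_nonneg N),
        QBinomial.scale, inv_pow])
  have hs2 : (fun N => QBinomial.scale N ^ 2) =o[atTop] QBinomial.scale := by
    simpa [sq] using (isBigO_refl QBinomial.scale atTop).mul_isLittleO
      QBinomial.scale_isLittleO_one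
  have hfirst : ∀ {x : ℕ → ℝ} {C D : ℝ},
      (fun N => x N - (C * QBinomial.scale N + D * QBinomial.scale N ^ 2)) =o[atTop]
        (fun N => QBinomial.scale N ^ 2) →
      (fun N => x N - C * QBinomial.scale N) =o[atTop] QBinomial.scale := by
    intro x C D h
    refine ((h.trans hs2).add (hs2.const_mul_left D)).congr_left fun N => ?_
    ring
  have hp₀ : QBinomial.bernoulliProb θ 1 = √θ ^ 2 / (1 + √θ ^ 2) := by
    rw [QBinomial.bernoulliProb, mul_one, ← hθsq]
  -- With `p₀ = θ / (1 + θ)`, the terms `-(1 - p₀) √θ` and `p₀ / √θ` cancel. At second order, the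
  -- `-C ^ 2 / 2` of the logarithm turns `ζ` into `ζ - 1`.
  have hM : (fun N => (1 - QBinomial.bernoulliProb θ 1) * Real.log (a N)
      + QBinomial.bernoulliProb θ 1 * Real.log (b N)
      - (-(1 - ζ) * (σ ^ 2 / 2) * T) * QBinomial.scale N ^ 2)
      =o[atTop] fun N => QBinomial.scale N ^ 2 := by
    refine ((ha2.const_mul_left (1 - QBinomial.bernoulliProb θ 1)).add
      (hb2.const_mul_left (QBinomial.bernoulliProb θ 1))).congr_left fun N => ?_
    rw [hp₀]
    rw [show -(1 - ζ) * (σ ^ 2 / 2) * T = -(1 - ζ) * (σ ^ 2 / 2) * √T ^ 2 by rw [← hTsq]]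
    field_simp
    ring
  have hn : ∀ (i : Fin p) (N : ℕ), ⌊(N : ℝ) * (t i : ℝ) / T⌋₊ ≤ N := fun i N => by
    refine Nat.floor_le_of_le ?_
    rw [div_le_iff₀ hT]
    exact mul_le_mul_of_nonneg_left (t i).2.2 (Nat.cast_nonneg N)
  have hτ : ∀ i : Fin p, Tendsto (fun N : ℕ => (⌊(N : ℝ) * (t i : ℝ) / T⌋₊ : ℝ) / N) atTop
      (𝓝 ((t i : ℝ) / T)) := fun i => by
    refine ((tendsto_nat_floor_mul_div_atTop (R := ℝ) (div_nonneg (t i).2.1 hT.le)).comp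
      tendsto_natCast_atTop_atTop).congr fun N => ?_
    simp only [Function.comp]
    rw [div_mul_eq_mul_div, mul_comm]
  refine QBinomial.tendstoInDistribution_of_tendsto_integral_exp
    (fun N => aemeasurable_pi_lambda _ fun i => (hX N).aemeasurable_log_price _ _ _ _)
    (aemeasurable_pi_lambda _ fun i =>
      ((hB.toIsPreBrownianReal.aemeasurable _).const_mul _).const_add _)
    fun c => ?_
  have hlim : ∫ ω, Complex.exp (((∑ i, c i * (Real.log S₀ + σ * η * √θ / (2 * (1 + θ)) *
      (t i : ℝ) ^ 2 - (1 - ζ) * (σ ^ 2 / 2) * (t i : ℝ)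
        + σ * B (⟨(t i : ℝ), (t i).2.1⟩ : ℝ≥0) ω) : ℝ) : ℂ) * Complex.I) ∂P'
      = Complex.exp (((∑ i, c i) * Real.log S₀ : ℝ) * Complex.I) * Complex.exp
        (((∑ i, c i * (-(1 - ζ) * (σ ^ 2 / 2) * T * ((t i : ℝ) / T) + θ / (1 + θ) ^ 2 *
          (η * √T ^ 3) * (σ * √T / √θ - -(σ * √θ * √T)) * ((t i : ℝ) / T) ^ 2 / 2) : ℝ) : ℂ)
            * Complex.I
          - ((∑ i, ∑ j, c i * c j * (((1 - QBinomial.bernoulliProb θ 1) * (-(σ * √θ * √T)) ^ 2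
            + QBinomial.bernoulliProb θ 1 * (σ * √T / √θ) ^ 2)
            * min ((t i : ℝ) / T) ((t j : ℝ) / T)) : ℝ) : ℂ) / 2) := by
    have hdrift : ∀ x : ℝ, -(1 - ζ) * (σ ^ 2 / 2) * T * (x / T) + θ / (1 + θ) ^ 2 *
          (η * √T ^ 3) * (σ * √T / √θ - -(σ * √θ * √T)) * (x / T) ^ 2 / 2
        = σ * η * √θ / (2 * (1 + θ)) * x ^ 2 - (1 - ζ) * (σ ^ 2 / 2) * x := fun x => by
      have h1 : θ / (1 + θ) ^ 2 * (η * √T ^ 3) * (σ * √T / √θ - -(σ * √θ * √T)) * (x / T) ^ 2 / 2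
          = σ * η * √θ / (2 * (1 + θ)) * x ^ 2 := by
        rw [show θ / (1 + θ) ^ 2 = √θ ^ 2 / (1 + √θ ^ 2) ^ 2 by rw [← hθsq],
          show (1 + θ) = 1 + √θ ^ 2 by rw [← hθsq], show x / T = x / √T ^ 2 by rw [← hTsq]]
        field_simp
        ring
      rw [h1]
      field_simp
      ring
    have hvar : ∀ x y : ℝ, ((1 - QBinomial.bernoulliProb θ 1) * (-(σ * √θ * √T)) ^ 2
            + QBinomial.bernoulliProb θ 1 * (σ * √T / √θ) ^ 2) * min (x / T) (y / T)
        = σ ^ 2 * min x y := fun x y => by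
      have h1 : (1 - QBinomial.bernoulliProb θ 1) * (-(σ * √θ * √T)) ^ 2
            + QBinomial.bernoulliProb θ 1 * (σ * √T / √θ) ^ 2 = σ ^ 2 * T := by
        rw [hp₀, show σ ^ 2 * T = σ ^ 2 * √T ^ 2 by rw [← hTsq]]
        field_simp
        ring
      rw [h1, min_div_div_right hT.le]
      field_simp
    simp_rw [hdrift, hvar]
    have hsplit : ∀ ω, Complex.exp (((∑ i, c i * (Real.log S₀ + σ * η * √θ / (2 * (1 + θ)) *
          (t i : ℝ) ^ 2 - (1 - ζ) * (σ ^ 2 / 2) * (t i : ℝ)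
          + σ * B (⟨(t i : ℝ), (t i).2.1⟩ : ℝ≥0) ω) : ℝ) : ℂ) * Complex.I)
        = Complex.exp (((∑ i, c i) * Real.log S₀ : ℝ) * Complex.I) * Complex.exp
          (((∑ i, c i * (σ * η * √θ / (2 * (1 + θ)) * (t i : ℝ) ^ 2
            - (1 - ζ) * (σ ^ 2 / 2) * (t i : ℝ)) : ℝ) : ℂ) * Complex.I) *
          Complex.exp (((∑ i, (c i * σ) * B (⟨(t i : ℝ), (t i).2.1⟩ : ℝ≥0) ω : ℝ) : ℂ)
            * Complex.I) := fun ω => by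
      rw [← Complex.exp_add, ← Complex.exp_add, ← add_mul, ← add_mul, ← Complex.ofReal_add,
        ← Complex.ofReal_add, Finset.sum_mul, ← Finset.sum_add_distrib, ← Finset.sum_add_distrib]
      congr 4
      funext i
      ring
    simp_rw [hsplit]
    rw [integral_const_mul, QBinomial.integral_exp_brownian hB.toIsPreBrownianReal
      (fun i => (⟨(t i : ℝ), (t i).2.1⟩ : ℝ≥0)), mul_assoc, ← Complex.exp_add]
    congr 2
    have hcov : ∑ i, ∑ j, c i * σ * (c j * σ) * min (t i : ℝ) (t j)
        = ∑ i, ∑ j, c i * c j * (σ ^ 2 * min (t i : ℝ) (t j)) :=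
      Finset.sum_congr rfl fun i _ => Finset.sum_congr rfl fun j _ => by ring
    rw [← hcov, sub_eq_add_neg, neg_div]
    rfl
  rw [hlim]
  refine ((QBinomial.tendsto_prod_stepChar hθ hq_pos hq2 (hfirst ha2) (hfirst hb2) hM c
    (fun i N => ⌊(N : ℝ) * (t i : ℝ) / T⌋₊) hn (fun i => (t i : ℝ) / T) hτ).const_mul
    _).congr' ?_
  -- The product formula needs `a N` and `b N` positive, which holds only for large `N`.
  filter_upwards [ha1.eventually (lt_mem_nhds one_pos), hb1.eventually (lt_mem_nhds one_pos)]
    with N haN hbN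
  exact ((hX N).integral_exp_log_price hθ (hq_pos N) hS₀ haN hbN c _ N fun i => hn i N).symm
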